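/- **Setting.** For $a>0$, $s\in\mathbb R$ put $A_a=\begin{pmatrix}a&0\\0&\sqrt a\end{pmatrix}$ and $S_s=\begin{pmatrix}1&s\\0&1\end{pmatrix}$. The shearlet group $\mathbb S$ is $\mathbb R^+\times\mathbb R\times\mathbb R^2$ (with its usual topology) with the product $$(a,s,t)\cdot(a',s',t')=(a'a,\;s'+s\sqrt{a'},\;t'+S_{s'}A_{a'}t),$$ and left Haar measure $\mu_{\mathbb S}=\frac{da\,ds\,dt}{a}$. The continuous shearlet transform of $f$ with respect to $\psi$ is $$\mathcal{SH}_\psi f(a,s,t)=\langle f,\,a^{3/4}\psi(S_sA_a\cdot{}-t)\rangle=\int_{\mathbb R^2}f(x)\,\overline{a^{3/4}\psi(S_sA_ax-t)}\,dx,\qquad (a,s,t)\in\mathbb S.$$ **Boxes and amalgam space.** Let $Q_1=[e^{-1/2},e^{1/2})\times[-\frac12,\frac12)\times[-\frac12,\frac12)^2\subset\mathbb S$ and $Q_1(x,y,z)=(x,y,z)\cdot Q_1$ for $(x,y,z)\in\mathbb S$. The space $W_{\mathbb S}(C,L^1)$ consists of all continuous functions $F:\mathbb S\to\mathbb C$ with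 $F\in L^1(\mathbb S,\mu_{\mathbb S})$ and $$\sum_{j,k\in\mathbb Z}\ \sum_{m\in\mathbb Z^2}\big\|F\cdot\chi_{Q_1(e^j,\,e^{-1/4}k,\,e^{-1/2}m)}\big\|_{L^\infty(\mathbb S,\mu_{\mathbb S})}<\infty .$$ **Generator class.** With $\hat\psi(\xi)=\int_{\mathbb R^2}\psi(x)e^{-2\pi i\langle x,\xi\rangle}dx$, let $\mathcal B_0$ be the set of Schwartz functions $\psi:\mathbb R^2\to\mathbb C$ for which there are real numbers $C>0$, $\alpha>\frac32$, $\beta>4\alpha+2$, $0<a_0<a_1$ and $b>0$ such that 1. $|\psi(x)|\le \dfrac{C}{(1+\|x\|_\infty^2)^{\alpha}}$ for all $x\in\mathbb R^2$; 2. $\operatorname{supp}\hat\psi\subset\big([-a_1,-a_0]\cup[a_0,a_1]\big)\times[-b,b]$, and $|\hat\psi(\xi)|\le\dfrac{|\xi_1|^{2\beta}}{(1+\|\xi\|_\infty^2)^{2\beta}}$ for all $\xi\in\mathbb R^2$. **Theorem.** If $f,\psi\in\mathcal B_0$, then $\mathcal{SH}_\psi f\in W_{\mathbb S}(C,L^1)$.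 -/

import Mathlib

open MeasureTheory SchwartzMap FourierTransform
open scoped ENNReal ComplexConjugate

noncomputable section

/-- The plane `ℝ²` (with Lebesgue measure as its `volume`). -/
abbrev Plane : Type := EuclideanSpace ℝ (Fin 2)

/-- The maximum norm on `ℝ²`. -/
def supNorm (x : Plane) : ℝ := max |x 0| |x 1|

/-- The parabolic scaling matrix `A_a`. -/
def scalingMatrix (a : ℝ) : Matrix (Fin 2) (Fin 2) ℝ := !![a, 0; 0, √a]

/-- The shear matrix `S_s`. -/
def shearMatrix (s : ℝ) : Matrix (Fin 2) (Fin 2) ℝ := !![1, s; 0, 1]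

/-- The map `x ↦ S_s A_a x` on the plane. -/
def shearScale (s a : ℝ) (x : Plane) : Plane :=
  WithLp.toLp 2 ((shearMatrix s).mulVec ((scalingMatrix a).mulVec x.ofLp))

theorem shearScale_apply_zero (s a : ℝ) (x : Plane) :
    shearScale s a x 0 = a * x 0 + s * (√a * x 1) := by
  simp [shearScale, shearMatrix, scalingMatrix, dotProduct, Fin.sum_univ_two]
  ring

theorem shearScale_apply_one (s a : ℝ) (x : Plane) :
    shearScale s a x 1 = √a * x 1 := by
  simp [shearScale, shearMatrix, scalingMatrix, dotProduct, Fin.sum_univ_two]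

/-- The underlying space `ℝ⁺ × ℝ × ℝ²` of the shearlet group. -/
def ShearletGroup : Type := Set.Ioi (0 : ℝ) × ℝ × Plane

namespace ShearletGroup

/-- The element `(a, s, t)` of the shearlet group, for `a > 0`. -/
def mk (a : ℝ) (ha : 0 < a) (s : ℝ) (t : Plane) : ShearletGroup := (⟨a, ha⟩, s, t)

/-- The scale parameter `a`. -/
def scale (g : ShearletGroup) : ℝ := g.1.1

/-- The shear parameter `s`. -/
def shear (g : ShearletGroup) : ℝ := g.2.1

/-- The translation parameter `t`. -/
def trans (g : ShearletGroup) : Plane := g.2.2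

theorem scale_pos (g : ShearletGroup) : 0 < g.scale := g.1.2

@[simp] theorem scale_mk (a : ℝ) (ha : 0 < a) (s : ℝ) (t : Plane) : (mk a ha s t).scale = a := rfl

@[simp] theorem shear_mk (a : ℝ) (ha : 0 < a) (s : ℝ) (t : Plane) : (mk a ha s t).shear = s := rfl

@[simp] theorem trans_mk (a : ℝ) (ha : 0 < a) (s : ℝ) (t : Plane) : (mk a ha s t).trans = t := rfl

theorem ext_coords {g h : ShearletGroup} (h₁ : g.scale = h.scale) (h₂ : g.shear = h.shear)
    (h₃ : g.trans = h.trans) : g = h :=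
  Prod.ext (Subtype.ext h₁) (Prod.ext h₂ h₃)

/-- The topology is that of `(0, ∞) × ℝ × ℝ²`. -/
instance : TopologicalSpace ShearletGroup :=
  inferInstanceAs (TopologicalSpace (Set.Ioi (0 : ℝ) × ℝ × Plane))

instance : MeasurableSpace ShearletGroup :=
  inferInstanceAs (MeasurableSpace (Set.Ioi (0 : ℝ) × ℝ × Plane))

instance : BorelSpace ShearletGroup :=
  inferInstanceAs (BorelSpace (Set.Ioi (0 : ℝ) × ℝ × Plane))

/-- `(a, s, t) · (a', s', t') = (a' a, s' + s √a', t' + S_{s'} A_{a'} t)`. -/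
instance : Mul ShearletGroup where
  mul g g' := mk (g'.scale * g.scale) (mul_pos g'.scale_pos g.scale_pos)
    (g'.shear + g.shear * √g'.scale) (g'.trans + shearScale g'.shear g'.scale g.trans)

instance : One ShearletGroup where
  one := mk 1 one_pos 0 0

instance : Inv ShearletGroup where
  inv g := mk g.scale⁻¹ (inv_pos.2 g.scale_pos) (-(g.shear * √(g.scale⁻¹)))
    (-shearScale (-(g.shear * √(g.scale⁻¹))) g.scale⁻¹ g.trans)

@[simp] theorem scale_mul (g g' : ShearletGroup) : (g * g').scale = g'.scale * g.scale := rfl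

@[simp] theorem shear_mul (g g' : ShearletGroup) :
    (g * g').shear = g'.shear + g.shear * √g'.scale := rfl

@[simp] theorem trans_mul (g g' : ShearletGroup) :
    (g * g').trans = g'.trans + shearScale g'.shear g'.scale g.trans := rfl

@[simp] theorem scale_one : (1 : ShearletGroup).scale = 1 := rfl

@[simp] theorem shear_one : (1 : ShearletGroup).shear = 0 := rfl

@[simp] theorem trans_one : (1 : ShearletGroup).trans = 0 := rfl

@[simp] theorem scale_inv (g : ShearletGroup) : g⁻¹.scale = g.scale⁻¹ := rfl

@[simp] theorem shear_inv (g : ShearletGroup) : g⁻¹.shear = -(g.shear * √(g.scale⁻¹)) := rfl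

@[simp] theorem trans_inv (g : ShearletGroup) :
    g⁻¹.trans = -shearScale (-(g.shear * √(g.scale⁻¹))) g.scale⁻¹ g.trans := rfl

instance : Group ShearletGroup :=
  Group.ofLeftAxioms
    (by
      intro g g' g''
      have h' := g'.scale_pos
      have h'' := g''.scale_pos
      have hs : √(g''.scale * g'.scale) = √g''.scale * √g'.scale := Real.sqrt_mul h''.le _
      have hq : √g''.scale * √g''.scale = g''.scale := Real.mul_self_sqrt h''.le
      refine ext_coords ?_ ?_ ?_
      · simp only [scale_mul]; ring
      · simp only [scale_mul, shear_mul, hs]; ring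
      · ext i
        fin_cases i
        · simp [shearScale_apply_zero, shearScale_apply_one, hs]
          linear_combination (-(g'.shear * √g'.scale * g.trans 1)) * hq
        · simp [shearScale_apply_one, hs]
          ring)
    (by
      intro g
      refine ext_coords ?_ ?_ ?_
      · simp
      · simp
      · ext i
        fin_cases i <;> simp [shearScale_apply_zero, shearScale_apply_one])
    (by
      intro g
      have h := g.scale_pos
      have hs : √(g.scale⁻¹) * √g.scale = 1 := by
        rw [← Real.sqrt_mul (inv_pos.2 h).le, inv_mul_cancel₀ h.ne', Real.sqrt_one]
      have hi : √(g.scale⁻¹) * √(g.scale⁻¹) = g.scale⁻¹ :=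
        Real.mul_self_sqrt (inv_pos.2 h).le
      refine ext_coords ?_ ?_ ?_
      · simp [h.ne']
      · simp only [shear_mul, shear_inv, shear_one]
        linear_combination (-g.shear) * hs
      · rw [Real.sqrt_inv] at hs hi
        ext i
        fin_cases i
        · simp [shearScale_apply_zero, shearScale_apply_one]
          linear_combination (-(g.trans 0)) * (mul_inv_cancel₀ h.ne')
            + (g.scale * g.shear * g.trans 1) * hi + (g.shear * g.trans 1) * mul_inv_cancel₀ h.ne'
            - (g.shear * g.trans 1) * hs
        · simp [shearScale_apply_one]
          linear_combination (-(g.trans 1)) * hs)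

/-- The left Haar measure `da ds dt / a`. -/
def haar : Measure ShearletGroup :=
  ((Measure.comap Subtype.val volume : Measure (Set.Ioi (0 : ℝ))).withDensity
    (fun a => ENNReal.ofReal ((a : ℝ)⁻¹))).prod
      ((volume : Measure ℝ).prod (volume : Measure Plane))

/-- The box `Q_h = [e^{-h/2}, e^{h/2}) × [-h/2, h/2) × [-h/2, h/2)²` around the unit. -/
def unitBox (h : ℝ) : Set ShearletGroup :=
  {g | g.scale ∈ Set.Ico (Real.exp (-h / 2)) (Real.exp (h / 2)) ∧
    g.shear ∈ Set.Ico (-h / 2) (h / 2) ∧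
    ∀ i, g.trans i ∈ Set.Ico (-h / 2) (h / 2)}

/-- The left translate `Q_h(g) = g · Q_h`. -/
def box (h : ℝ) (g : ShearletGroup) : Set ShearletGroup := (fun q => g * q) '' unitBox h

/-- The centre `(e^j, e^{-1/4} k, e^{-1/2} m)`. -/
def latticePoint (j k : ℤ) (m : Fin 2 → ℤ) : ShearletGroup :=
  mk (Real.exp j) (Real.exp_pos _) (Real.exp (-1 / 4) * k)
    (WithLp.toLp 2 (fun i => Real.exp (-1 / 2) * (m i : ℝ)))

end ShearletGroup

open ShearletGroup

/-- The amalgam norm of `W_𝕊(L^∞, L^p)`, with values in `[0, ∞]`: the `ℓ^p` norm of the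
`L^∞` norms on the boxes `Q_1(e^j, e^{-1/4} k, e^{-1/2} m)`. -/
def amalgamNorm (p : ℝ) (F : ShearletGroup → ℂ) : ℝ≥0∞ :=
  (∑' (j : ℤ) (k : ℤ) (m : Fin 2 → ℤ),
    eLpNorm ((box 1 (latticePoint j k m)).indicator F) ∞ haar ^ p) ^ (1 / p)

/-- The amalgam space `W_𝕊(L^∞, L^p)` (as a set of functions), for `1 ≤ p < ∞`. -/
def amalgamSpace (p : ℝ) : Set (ShearletGroup → ℂ) :=
  {F | MemLp F (ENNReal.ofReal p) haar ∧ amalgamNorm p F < ∞}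

/-- The amalgam space `W_𝕊(C, L^p) = W_𝕊(L^∞, L^p) ∩ C(𝕊)`. -/
def continuousAmalgamSpace (p : ℝ) : Set (ShearletGroup → ℂ) :=
  amalgamSpace p ∩ {F | Continuous F}

/-- The representation `(σ(a, s, t) ψ)(x) = a^{3/4} ψ(S_s A_a x - t)`. -/
def shearletRep (g : ShearletGroup) (ψ : Plane → ℂ) (x : Plane) : ℂ :=
  ((g.scale ^ (3 / 4 : ℝ) : ℝ) : ℂ) * ψ (shearScale g.shear g.scale x - g.trans)

/-- The continuous shearlet transform `SH_ψ f (a, s, t) = ⟨f, σ(a, s, t) ψ⟩`, where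
`⟨u, v⟩` is the `L²` inner product, the integral of `u` times the conjugate of `v`. -/
def shearletTransform (ψ f : Plane → ℂ) (g : ShearletGroup) : ℂ :=
  ∫ x : Plane, f x * conj (shearletRep g ψ x)

/-- The generator class `𝓑₀`. The Fourier transform is that with kernel `e^{-2πi⟨x, ξ⟩}`. -/
def generatorClass : Set 𝓢(Plane, ℂ) :=
  {ψ | ∃ C α β a₀ a₁ b : ℝ, 0 < C ∧ 3 / 2 < α ∧ 4 * α + 2 < β ∧ 0 < a₀ ∧ a₀ < a₁ ∧ 0 < b ∧
    (∀ x : Plane, ‖ψ x‖ ≤ C / (1 + supNorm x ^ 2) ^ α) ∧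
    tsupport (𝓕 (ψ : Plane → ℂ)) ⊆
      {ξ | ξ 0 ∈ Set.Icc (-a₁) (-a₀) ∪ Set.Icc a₀ a₁ ∧ ξ 1 ∈ Set.Icc (-b) b} ∧
    ∀ ξ : Plane, ‖𝓕 (ψ : Plane → ℂ) ξ‖ ≤ |ξ 0| ^ (2 * β) / (1 + supNorm ξ ^ 2) ^ (2 * β)}

end

open ShearletGroup

/-! The transform vanishes outside a compact set of scales and shears, and there it decays rapidly
in the translation. By Parseval it pairs `𝓕 f` with the Fourier transform of the atom, which lives
on the image of the support of `𝓕 ψ` under the transpose of S_s A_a. Both supports are bounded and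
keep |ξ₁| away from 0, so they meet only for a in a compact part of (0, ∞) and s bounded
(`exists_scale_shear_support`). For such (a, s), Schwartz decay gives the bound C / (1 + ‖t‖)³
(`exists_norm_shearletTransform_le`). Since 3 exceeds the dimension 2, this yields integrability. By
`abs_le_of_mem_box`, only finitely many j and k contribute to the box sum, and the sum over m ∈ ℤ²
converges. -/

theorem Plane.abs_apply_le_norm (x : Plane) (i : Fin 2) : |x i| ≤ ‖x‖ := by
  simpa using PiLp.norm_apply_le x i

theorem Plane.norm_le_abs_add_abs (x : Plane) : ‖x‖ ≤ |x 0| + |x 1| := by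
  rw [EuclideanSpace.norm_eq, Fin.sum_univ_two]
  refine Real.sqrt_le_iff.2 ⟨by positivity, ?_⟩
  simp only [Real.norm_eq_abs]
  nlinarith [abs_nonneg (x 0), abs_nonneg (x 1)]

/-! ### Shearlet atoms as Schwartz functions -/

/-- `x ↦ S_s A_a x` as a linear automorphism of the plane, for `a > 0`. -/
noncomputable def shearScaleEquiv (s a : ℝ) (ha : 0 < a) : Plane ≃L[ℝ] Plane :=
  LinearEquiv.toContinuousLinearEquiv
    { toFun := shearScale s a
      map_add' := fun x y => by
        ext i
        fin_cases i <;> simp [shearScale_apply_zero, shearScale_apply_one] <;> ring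
      map_smul' := fun c x => by
        ext i
        fin_cases i <;> simp [shearScale_apply_zero, shearScale_apply_one] <;> ring
      invFun := fun x => WithLp.toLp 2 ![(x 0 - s * x 1) / a, x 1 / √a]
      left_inv := fun x => by
        have h := (Real.sqrt_pos.2 ha).ne'
        ext i
        fin_cases i <;> simp [shearScale_apply_zero, shearScale_apply_one] <;> field_simp
      right_inv := fun x => by
        have h := (Real.sqrt_pos.2 ha).ne'
        ext i
        fin_cases i <;> simp [shearScale_apply_zero, shearScale_apply_one] <;> field_simp
        ring }

@[simp] theorem shearScaleEquiv_apply (s a : ℝ) (ha : 0 < a) (x : Plane) :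
    shearScaleEquiv s a ha x = shearScale s a x := rfl

/-- The Schwartz function `x ↦ ψ (S_s A_a x - t)`. -/
noncomputable def shearletAtom (ψ : 𝓢(Plane, ℂ)) (g : ShearletGroup) : 𝓢(Plane, ℂ) :=
  compCLMOfContinuousLinearEquiv ℂ (shearScaleEquiv g.shear g.scale g.scale_pos)
    (compSubConstCLM ℂ g.trans ψ)

@[simp] theorem shearletAtom_apply (ψ : 𝓢(Plane, ℂ)) (g : ShearletGroup) (x : Plane) :
    shearletAtom ψ g x = ψ (shearScale g.shear g.scale x - g.trans) := by
  simp [shearletAtom]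

theorem shearletTransform_eq (ψ f : 𝓢(Plane, ℂ)) (g : ShearletGroup) :
    shearletTransform ψ f g =
      ((g.scale ^ (3 / 4 : ℝ) : ℝ) : ℂ) * ∫ x, f x * conj (shearletAtom ψ g x) := by
  rw [shearletTransform, ← integral_const_mul]
  congr 1 with x
  simp [shearletRep]
  ring

/-! ### Fourier supports confine scale and shear -/

/-- The transpose of `S_s A_a`. -/
noncomputable def shearScaleTranspose (s a : ℝ) (η : Plane) : Plane :=
  WithLp.toLp 2 ![a * η 0, √a * (s * η 0 + η 1)]

theorem inner_shearScaleTranspose (s a : ℝ) (x η : Plane) :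
    inner ℝ x (shearScaleTranspose s a η) = inner ℝ (shearScale s a x) η := by
  simp [PiLp.inner_apply, Fin.sum_univ_two, shearScaleTranspose, shearScale_apply_zero,
    shearScale_apply_one]
  ring

theorem exists_shearScaleTranspose_eq (s a : ℝ) (ha : 0 < a) (ξ : Plane) :
    ∃ η, shearScaleTranspose s a η = ξ := by
  have h := (Real.sqrt_pos.2 ha).ne'
  refine ⟨WithLp.toLp 2 ![ξ 0 / a, ξ 1 / √a - s * (ξ 0 / a)], ?_⟩
  ext i
  fin_cases i <;> simp [shearScaleTranspose] <;> field_simp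

/-- Substituting y = S_s A_a x makes the left side a constant times a unimodular factor times `𝓕 ψ
η`. Only vanishing matters, so the Jacobian is never computed. -/
theorem fourier_shearletAtom_eq_zero (ψ : 𝓢(Plane, ℂ)) (g : ShearletGroup) {η : Plane}
    (h : 𝓕 (ψ : Plane → ℂ) η = 0) :
    𝓕 (shearletAtom ψ g : Plane → ℂ) (shearScaleTranspose g.shear g.scale η) = 0 := by
  set B := shearScaleEquiv g.shear g.scale g.scale_pos
  set F : Plane → ℂ := fun y => Real.fourierChar (-inner ℝ y η) • ψ (y - g.trans)
  have key : ∀ x, Real.fourierChar (-inner ℝ x (shearScaleTranspose g.shear g.scale η)) •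
      shearletAtom ψ g x = F (B x) := fun x => by
    simp [F, B, inner_shearScaleTranspose]
  have hF : ∫ y, F y = 0 := by
    -- Undoing the translation by t only pulls out a character value.
    rw [← integral_add_right_eq_self F g.trans]
    have : ∀ y, F (y + g.trans) = Real.fourierChar (-inner ℝ g.trans η) •
        (Real.fourierChar (-inner ℝ y η) • ψ y) := fun y => by
      simp only [F, inner_add_left, neg_add, add_sub_cancel_right]
      rw [smul_smul, ← AddChar.map_add_eq_mul, add_comm]
    simp_rw [this, Circle.smul_def, integral_smul]
    rw [Real.fourier_eq] at h
    simp_rw [Circle.smul_def] at h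
    rw [h, smul_zero]
  rw [Real.fourier_eq]
  simp_rw [key]
  have hmap := Measure.map_linearMap_addHaar_eq_smul_addHaar (volume : Measure Plane)
    (f := (B.toLinearEquiv : Plane →ₗ[ℝ] Plane)) (LinearEquiv.isUnit_det' _).ne_zero
  have := B.toHomeomorph.measurableEmbedding.integral_map (μ := (volume : Measure Plane)) F
  change ∫ y, F y ∂(Measure.map (⇑(B.toLinearEquiv : Plane →ₗ[ℝ] Plane)) volume) =
    ∫ x, F (B x) at this
  rw [← this, hmap, integral_smul_measure, hF, smul_zero]

/-- By Parseval, the integral becomes one over frequencies ξ. The transpose is onto, so every ξ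
comes from some η, and one of the two factors vanishes there. -/
theorem shearletTransform_eq_zero (ψ f : 𝓢(Plane, ℂ)) (g : ShearletGroup)
    (h : ∀ η, 𝓕 (f : Plane → ℂ) (shearScaleTranspose g.shear g.scale η) = 0 ∨
      𝓕 (ψ : Plane → ℂ) η = 0) :
    shearletTransform ψ f g = 0 := by
  rw [shearletTransform_eq]
  have key := SchwartzMap.integral_inner_fourier_fourier (shearletAtom ψ g) f
  simp only [RCLike.inner_apply] at key
  rw [← key, integral_eq_zero_of_ae, mul_zero]
  refine Filter.Eventually.of_forall fun ξ => ?_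
  obtain ⟨η, rfl⟩ := exists_shearScaleTranspose_eq g.shear g.scale g.scale_pos ξ
  rw [SchwartzMap.fourier_coe, SchwartzMap.fourier_coe]
  rcases h η with h | h
  · simp [h]
  · simp [fourier_shearletAtom_eq_zero ψ g h]

theorem exists_fourier_support {ψ : 𝓢(Plane, ℂ)} (hψ : ψ ∈ generatorClass) :
    ∃ a₀ a₁ b : ℝ, 0 < a₀ ∧ 0 < a₁ ∧ ∀ ξ, 𝓕 (ψ : Plane → ℂ) ξ ≠ 0 →
      a₀ ≤ |ξ 0| ∧ |ξ 0| ≤ a₁ ∧ |ξ 1| ≤ b := by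
  obtain ⟨C, α, β, a₀, a₁, b, -, -, -, h₀, h₁, -, -, hsupp, -⟩ := hψ
  refine ⟨a₀, a₁, b, h₀, h₀.trans h₁, fun ξ hξ => ?_⟩
  obtain ⟨h | h, h'⟩ := hsupp (subset_tsupport _ hξ)
  · rw [abs_of_neg (by linarith [h.2])]
    exact ⟨by linarith [h.2], by linarith [h.1], abs_le.2 h'⟩
  · rw [abs_of_pos (by linarith [h.1])]
    exact ⟨h.1, h.2, abs_le.2 h'⟩

theorem exists_scale_shear_support {f ψ : 𝓢(Plane, ℂ)} (hf : f ∈ generatorClass)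
    (hψ : ψ ∈ generatorClass) :
    ∃ l u R : ℝ, 0 < l ∧ ∀ g, shearletTransform ψ f g ≠ 0 →
      l ≤ g.scale ∧ g.scale ≤ u ∧ |g.shear| ≤ R := by
  obtain ⟨c₀, c₁, d, hc₀, hc₁, hF⟩ := exists_fourier_support hf
  obtain ⟨a₀, a₁, b, ha₀, ha₁, hP⟩ := exists_fourier_support hψ
  have hl : 0 < c₀ / a₁ := by positivity
  have hsl := Real.sqrt_pos.2 hl
  -- At a common frequency, a|η₀| lies in [c₀, c₁] and |η₀| in [a₀, a₁], which gives the scale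
  -- bounds. The second coordinate gives √a |s η₀ + η₁| ≤ d with |η₁| ≤ b; the lower bounds on a and
  -- |η₀| then bound s.
  refine ⟨c₀ / a₁, c₁ / a₀, (d / √(c₀ / a₁) + b) / a₀, hl, fun g hg => ?_⟩
  have : ∃ η, 𝓕 (f : Plane → ℂ) (shearScaleTranspose g.shear g.scale η) ≠ 0 ∧
      𝓕 (ψ : Plane → ℂ) η ≠ 0 := by
    by_contra! H
    exact hg (shearletTransform_eq_zero ψ f g fun η => by
      by_cases h : 𝓕 (f : Plane → ℂ) (shearScaleTranspose g.shear g.scale η) = 0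
      · exact Or.inl h
      · exact Or.inr (H η h))
  obtain ⟨η, h1, h2⟩ := this
  obtain ⟨p1, p2, p3⟩ := hF _ h1
  obtain ⟨q1, q2, q3⟩ := hP _ h2
  have hg := g.scale_pos
  have hsq := Real.sqrt_pos.2 hg
  simp only [shearScaleTranspose, Matrix.cons_val_zero, Matrix.cons_val_one, abs_mul,
    abs_of_pos hg, abs_of_pos hsq] at p1 p2 p3
  have hlow : c₀ / a₁ ≤ g.scale := by
    rw [div_le_iff₀ ha₁]
    nlinarith
  refine ⟨hlow, ?_, ?_⟩
  · rw [le_div_iff₀ ha₀]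
    nlinarith
  · have h3 : |g.shear * η 0 + η 1| ≤ d / √(c₀ / a₁) := by
      rw [le_div_iff₀ hsl]
      nlinarith [Real.sqrt_le_sqrt hlow, abs_nonneg (g.shear * η 0 + η 1)]
    have h4 : |g.shear * η 0| ≤ |g.shear * η 0 + η 1| + |η 1| := by
      simpa using abs_sub (g.shear * η 0 + η 1) (η 1)
    rw [abs_mul] at h4
    rw [le_div_iff₀ ha₀]
    nlinarith [abs_nonneg g.shear]

/-! ### Decay in the translation parameter -/

theorem SchwartzMap.exists_norm_le_div_one_add_norm_pow {E F : Type*} [NormedAddCommGroup E]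
    [NormedSpace ℝ E] [NormedAddCommGroup F] [NormedSpace ℝ F] (f : 𝓢(E, F)) (k : ℕ) :
    ∃ C : ℝ, 0 ≤ C ∧ ∀ x, ‖f x‖ ≤ C / (1 + ‖x‖) ^ k := by
  refine ⟨2 ^ k * (Finset.Iic (k, 0)).sup (fun m => SchwartzMap.seminorm ℝ m.1 m.2) f,
    by positivity, fun x => ?_⟩
  have := one_add_le_sup_seminorm_apply (𝕜 := ℝ) (m := (k, 0)) le_rfl le_rfl f x
  rw [norm_iteratedFDeriv_zero] at this
  rw [le_div_iff₀ (by positivity), mul_comm]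
  exact this

theorem norm_shearScale_le {s a u R : ℝ} (ha : 0 ≤ a) (hu : a ≤ u) (hs : |s| ≤ R) (x : Plane) :
    ‖shearScale s a x‖ ≤ (u + R * √u + √u) * ‖x‖ := by
  have h0 := Plane.abs_apply_le_norm x 0
  have h1 := Plane.abs_apply_le_norm x 1
  have hR : 0 ≤ R := (abs_nonneg s).trans hs
  have hu0 : 0 ≤ u := ha.trans hu
  have hq := Real.sqrt_le_sqrt hu
  have e1 : |a * x 0 + s * (√a * x 1)| ≤ u * ‖x‖ + R * (√u * ‖x‖) := by
    refine (abs_add_le _ _).trans ?_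
    rw [abs_mul, abs_mul, abs_mul, abs_of_nonneg ha, abs_of_nonneg (Real.sqrt_nonneg a)]
    gcongr
  have e2 : |√a * x 1| ≤ √u * ‖x‖ := by
    rw [abs_mul, abs_of_nonneg (Real.sqrt_nonneg a)]
    gcongr
  refine (Plane.norm_le_abs_add_abs _).trans ?_
  rw [shearScale_apply_zero, shearScale_apply_one]
  linarith

theorem integrable_one_div_one_add_norm_cube :
    Integrable (fun x : Plane => 1 / (1 + ‖x‖) ^ 3) := by
  have := integrable_one_add_norm (E := Plane) (μ := volume) (r := 3) (by simp; norm_num)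
  refine this.congr (Filter.Eventually.of_forall fun x => ?_)
  simp only
  rw [Real.rpow_neg (by positivity), one_div]
  norm_cast

/-- On bounded sets of scales and shears the shearlet transform decays in the translation. -/
theorem exists_norm_shearletTransform_le (ψ f : 𝓢(Plane, ℂ)) (u R : ℝ) :
    ∃ C : ℝ, 0 ≤ C ∧ ∀ g : ShearletGroup, g.scale ≤ u → |g.shear| ≤ R →
      ‖shearletTransform ψ f g‖ ≤ C / (1 + ‖g.trans‖) ^ 3 := by
  -- Of the six powers of decay of f, three are traded for decay in t and three make the integral in
  -- x converge.
  obtain ⟨C₁, hC₁, h₁⟩ := f.exists_norm_le_div_one_add_norm_pow 6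
  obtain ⟨C₂, hC₂, h₂⟩ := ψ.exists_norm_le_div_one_add_norm_pow 3
  set I : ℝ := ∫ x : Plane, 1 / (1 + ‖x‖) ^ 3
  have hI : 0 ≤ I := integral_nonneg fun x => by positivity
  by_cases huR : 0 ≤ u ∧ 0 ≤ R
  swap
  · refine ⟨0, le_rfl, fun g hg hs => absurd ⟨g.scale_pos.le.trans hg, (abs_nonneg _).trans hs⟩ huR⟩
  obtain ⟨hu, hR⟩ := huR
  set M := u + R * √u + √u
  have hM : 0 ≤ M := by positivity
  refine ⟨u ^ (3 / 4 : ℝ) * (C₁ * C₂ * (1 + M) ^ 3 * I), by positivity, fun g hg hs => ?_⟩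
  have hgs := g.scale_pos
  have hpt : ∀ x, ‖f x * conj (shearletAtom ψ g x)‖ ≤
      C₁ * C₂ * (1 + M) ^ 3 / (1 + ‖g.trans‖) ^ 3 * (1 / (1 + ‖x‖) ^ 3) := fun x => by
    rw [norm_mul, RCLike.norm_conj, shearletAtom_apply]
    set y := shearScale g.shear g.scale x - g.trans
    -- Peetre-type inequality: t = S_s A_a x - y, and M bounds the operator norm of S_s A_a.
    have hy : 1 + ‖g.trans‖ ≤ (1 + M) * (1 + ‖y‖) * (1 + ‖x‖) := by
      have e1 : ‖g.trans‖ ≤ ‖shearScale g.shear g.scale x‖ + ‖y‖ := by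
        simpa [y] using norm_sub_le (shearScale g.shear g.scale x) y
      have e2 := norm_shearScale_le hgs.le hg hs x
      have : 0 ≤ M * ‖y‖ := by positivity
      have : 0 ≤ M * ‖y‖ * ‖x‖ := by positivity
      have : 0 ≤ ‖y‖ * ‖x‖ := by positivity
      nlinarith [norm_nonneg x, norm_nonneg y]
    have hy3 := pow_le_pow_left₀ (by positivity) hy 3
    calc ‖f x‖ * ‖ψ y‖ ≤ C₁ / (1 + ‖x‖) ^ 6 * (C₂ / (1 + ‖y‖) ^ 3) := by
          gcongr
          exacts [h₁ x, h₂ y]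
      _ = C₁ * C₂ * (1 / ((1 + ‖y‖) * (1 + ‖x‖)) ^ 3) * (1 / (1 + ‖x‖) ^ 3) := by
          field_simp
      _ ≤ C₁ * C₂ * ((1 + M) ^ 3 / (1 + ‖g.trans‖) ^ 3) * (1 / (1 + ‖x‖) ^ 3) := by
          gcongr ?_ * ?_ * ?_
          rw [div_le_div_iff₀ (by positivity) (by positivity), one_mul, ← mul_pow, ← mul_assoc]
          exact hy3
      _ = _ := by ring
  have hint : ‖∫ x, f x * conj (shearletAtom ψ g x)‖ ≤
      C₁ * C₂ * (1 + M) ^ 3 / (1 + ‖g.trans‖) ^ 3 * I := by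
    rw [← integral_const_mul]
    exact norm_integral_le_of_norm_le (integrable_one_div_one_add_norm_cube.const_mul _)
      (Filter.Eventually.of_forall hpt)
  rw [shearletTransform_eq, norm_mul, Complex.norm_real, Real.norm_of_nonneg (by positivity)]
  calc _ ≤ u ^ (3 / 4 : ℝ) * (C₁ * C₂ * (1 + M) ^ 3 / (1 + ‖g.trans‖) ^ 3 * I) := by
        gcongr
    _ = _ := by ring

/-! ### Continuity and Haar integrability -/

namespace ShearletGroup

instance : SecondCountableTopology ShearletGroup :=
  inferInstanceAs (SecondCountableTopology (Set.Ioi (0 : ℝ) × ℝ × Plane))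

theorem continuous_scale : Continuous scale :=
  (continuous_subtype_val.comp continuous_fst :
    Continuous fun g : Set.Ioi (0 : ℝ) × ℝ × Plane => g.1.1)

theorem continuous_shear : Continuous shear :=
  (continuous_fst.comp continuous_snd :
    Continuous fun g : Set.Ioi (0 : ℝ) × ℝ × Plane => g.2.1)

theorem continuous_trans : Continuous trans :=
  (continuous_snd.comp continuous_snd :
    Continuous fun g : Set.Ioi (0 : ℝ) × ℝ × Plane => g.2.2)

end ShearletGroup

theorem continuous_shearScale_apply (x : Plane) :
    Continuous fun g : ShearletGroup => shearScale g.shear g.scale x := by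
  have h1 := continuous_scale
  have h2 := continuous_shear
  refine (PiLp.continuous_toLp 2 _).comp (continuous_pi fun i => ?_)
  fin_cases i
  · change Continuous fun g : ShearletGroup => shearScale g.shear g.scale x 0
    simp only [shearScale_apply_zero]
    fun_prop
  · change Continuous fun g : ShearletGroup => shearScale g.shear g.scale x 1
    simp only [shearScale_apply_one]
    fun_prop

theorem continuous_shearletTransform (ψ f : 𝓢(Plane, ℂ)) : Continuous (shearletTransform ψ f) := by
  -- Exponent 0 gives a uniform bound on ψ, so C‖f‖ dominates for every g.
  obtain ⟨C, hC, h⟩ := ψ.exists_norm_le_div_one_add_norm_pow 0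
  have e : shearletTransform ψ f = fun g => ((g.scale ^ (3 / 4 : ℝ) : ℝ) : ℂ) *
      ∫ x, f x * conj (shearletAtom ψ g x) := funext (shearletTransform_eq ψ f)
  rw [e]
  refine (Complex.continuous_ofReal.comp
    (continuous_scale.rpow_const fun g => Or.inl g.scale_pos.ne')).mul ?_
  refine continuous_of_dominated (bound := fun x => ‖f x‖ * C) (fun g => ?_)
    (fun g => Filter.Eventually.of_forall fun x => ?_) (f.integrable.norm.mul_const C)
    (Filter.Eventually.of_forall fun x => ?_)
  · exact (f.continuous.mul
      (Complex.continuous_conj.comp (shearletAtom ψ g).continuous)).aestronglyMeasurable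
  · rw [norm_mul, RCLike.norm_conj, shearletAtom_apply]
    gcongr
    simpa using h (shearScale g.shear g.scale x - g.trans)
  · simp only [shearletAtom_apply]
    exact continuous_const.mul (Complex.continuous_conj.comp
      (ψ.continuous.comp ((continuous_shearScale_apply x).sub continuous_trans)))

namespace ShearletGroup

/-- A continuous function bounded by an integrable profile in the translation, and supported in a
compact set of scales and shears, is integrable. -/
theorem integrable_haar_of_bound {F : ShearletGroup → ℂ} (hF : Continuous F) {l u R C : ℝ}
    (hl : 0 < l)
    (hsupp : ∀ g, F g ≠ 0 → l ≤ g.scale ∧ g.scale ≤ u ∧ |g.shear| ≤ R)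
    (hbound : ∀ g, ‖F g‖ ≤ C / (1 + ‖g.trans‖) ^ 3) : Integrable F haar := by
  set p : Set.Ioi (0 : ℝ) → ℝ := ((↑) ⁻¹' Set.Icc l u : Set (Set.Ioi (0 : ℝ))).indicator 1
  set q : ℝ → ℝ := (Set.Icc (-R) R).indicator 1
  have hp : Integrable p ((Measure.comap Subtype.val volume : Measure (Set.Ioi (0 : ℝ))).withDensity
      (fun a => ENNReal.ofReal ((a : ℝ)⁻¹))) := by
    have hm : MeasurableSet ((↑) ⁻¹' Set.Icc l u : Set (Set.Ioi (0 : ℝ))) :=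
      measurable_subtype_coe measurableSet_Icc
    refine (integrable_indicator_iff hm).2 (integrableOn_const ?_)
    rw [withDensity_apply _ hm]
    -- On [l, u] the Haar density 1/a is at most 1/l.
    refine ne_of_lt ((setLIntegral_mono (g := fun _ => ENNReal.ofReal l⁻¹) measurable_const
      fun a ha => ?_).trans_lt ?_)
    · exact ENNReal.ofReal_le_ofReal (inv_anti₀ hl ha.1)
    · rw [setLIntegral_const]
      refine ENNReal.mul_lt_top ENNReal.ofReal_lt_top ?_
      rw [comap_subtype_coe_apply measurableSet_Ioi]
      exact (measure_mono (Set.image_preimage_subset _ _)).trans_lt measure_Icc_lt_top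
  have hq : Integrable q := (integrable_indicator_iff measurableSet_Icc).2
    (integrableOn_const measure_Icc_lt_top.ne)
  have hr : Integrable fun x : Plane => C * (1 / (1 + ‖x‖) ^ 3) :=
    integrable_one_div_one_add_norm_cube.const_mul C
  have H := hp.mul_prod (hq.mul_prod hr)
  refine Integrable.mono' (g := fun g : ShearletGroup =>
    p g.1 * (q g.2.1 * (C * (1 / (1 + ‖g.2.2‖) ^ 3)))) H hF.aestronglyMeasurable
    (Filter.Eventually.of_forall fun g => ?_)
  by_cases hg : F g = 0
  · have hC : 0 ≤ C / (1 + ‖g.trans‖) ^ 3 := (norm_nonneg _).trans (hbound g)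
    rw [hg, norm_zero, mul_one_div]
    refine mul_nonneg (Set.indicator_nonneg (fun _ _ => zero_le_one) _)
      (mul_nonneg (Set.indicator_nonneg (fun _ _ => zero_le_one) _) hC)
  · obtain ⟨h1, h2, h3⟩ := hsupp g hg
    have e1 : p g.1 = 1 := Set.indicator_of_mem (by exact ⟨h1, h2⟩) _
    have e2 : q g.2.1 = 1 := Set.indicator_of_mem (by exact abs_le.1 h3) _
    rw [e1, e2, one_mul, one_mul, mul_one_div]
    exact hbound g

end ShearletGroup

/-! ### Summation over the boxes -/

theorem summable_one_div_one_add_norm_cube :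
    Summable fun m : Fin 2 → ℤ => 1 / (1 + ‖m‖) ^ 3 := by
  have h : Summable fun m : Fin 2 → ℤ => ‖m‖ ^ (-(3 : ℝ)) :=
    EisensteinSeries.summable_one_div_norm_rpow (by norm_num)
  refine Summable.of_norm_bounded_eventually h ?_
  -- The comparison fails at m = 0, where the real power of 0 is 0 by convention.
  filter_upwards [(Set.finite_singleton (0 : Fin 2 → ℤ)).compl_mem_cofinite] with m hm
  have hm' : 0 < ‖m‖ := norm_pos_iff.2 hm
  rw [Real.norm_of_nonneg (by positivity), Real.rpow_neg hm'.le, one_div]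
  norm_cast
  gcongr
  linarith

theorem Int.finite_setOf_abs_cast_le (r : ℝ) : {n : ℤ | |(n : ℝ)| ≤ r}.Finite := by
  refine (Set.finite_Icc (⌈-r⌉) ⌊r⌋).subset fun n hn => ?_
  exact ⟨Int.ceil_le.2 (abs_le.1 hn).1, Int.le_floor.2 (abs_le.1 hn).2⟩

theorem Int.summable_indicator_abs_cast_le (r : ℝ) :
    Summable ({n : ℤ | |(n : ℝ)| ≤ r}.indicator (1 : ℤ → ℝ)) :=
  summable_of_hasFiniteSupport ((Int.finite_setOf_abs_cast_le r).subset
    Set.support_indicator_subset)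

theorem Real.one_third_le_exp_neg_one : 1 / 3 ≤ Real.exp (-1) := by
  rw [Real.exp_neg, one_div]
  exact inv_anti₀ (Real.exp_pos _) (by linarith [Real.exp_one_lt_d9])

namespace ShearletGroup

/-- A point of the box is p · q with p the centre and q in the unit box, so its translation is that
of q plus S_{s_q} A_{a_q} e^{-1/2} m. Since q ranges over a bounded set on which these matrices have
bounded inverses, the indices are controlled by the coordinates of the point. The constants come
from e^{-1} ≥ 1/3 and are not sharp. -/
theorem abs_le_of_mem_box {j k : ℤ} {m : Fin 2 → ℤ} {g : ShearletGroup}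
    (hg : g ∈ box 1 (latticePoint j k m)) {l u R : ℝ} (hl : 0 < l) (h₁ : l ≤ g.scale)
    (h₂ : g.scale ≤ u) (h₃ : |g.shear| ≤ R) :
    |(j : ℝ)| ≤ |Real.log l| + |Real.log u| + 1 ∧ |(k : ℝ)| ≤ 3 * (R + 1) ∧
      1 + ‖m‖ ≤ 18 * (1 + ‖g.trans‖) := by
  obtain ⟨q, ⟨⟨ha₀, ha₁⟩, ⟨hs₀, hs₁⟩, ht⟩, rfl⟩ := hg
  have hq := q.scale_pos
  simp only [latticePoint, scale_mul, scale_mk, shear_mul, shear_mk] at h₁ h₂ h₃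
  have hexp : Real.exp (-1 / 2) * Real.exp (-1 / 2) = Real.exp (-1) := by
    rw [← Real.exp_add]; norm_num
  have hexp' : Real.exp (-1 / 4) * Real.exp (-1 / 4) = Real.exp (-1 / 2) := by
    rw [← Real.exp_add]; norm_num
  have hexp1 : Real.exp (1 / 2) * Real.exp (-1 / 2) = 1 := by
    rw [← Real.exp_add]; norm_num
  have hE := Real.one_third_le_exp_neg_one
  have hp2 := Real.exp_pos (-1 / 2)
  have hp4 := Real.exp_pos (-1 / 4)
  have hr₀ : Real.exp (-1 / 4) ≤ √q.scale :=
    Real.le_sqrt_of_sq_le (by rw [sq, hexp']; exact ha₀)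
  have hr₁ : √q.scale * Real.exp (-1 / 2) ≤ 1 := by
    have : √q.scale ≤ Real.exp (1 / 2) := by
      refine Real.sqrt_le_iff.2 ⟨(Real.exp_pos _).le, ha₁.le.trans ?_⟩
      rw [sq, ← Real.exp_add]
      exact Real.exp_le_exp.2 (by norm_num)
    nlinarith
  have h2le : Real.exp (-1 / 2) ≤ 1 := Real.exp_le_one_iff.2 (by norm_num)
  have h24 : Real.exp (-1 / 2) ≤ Real.exp (-1 / 4) := Real.exp_le_exp.2 (by norm_num)
  have hr₂ : 1 / 3 ≤ √q.scale * Real.exp (-1 / 2) := by nlinarith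
  have hq₂ : 1 / 3 ≤ q.scale * Real.exp (-1 / 2) := by nlinarith
  have hr₃ : 1 / 3 ≤ Real.exp (-1 / 4) * √q.scale := by nlinarith
  refine ⟨?_, ?_, ?_⟩
  · have e1 : Real.log (q.scale * Real.exp j) = Real.log q.scale + j := by
      rw [Real.log_mul hq.ne' (Real.exp_pos _).ne', Real.log_exp]
    have e2 := Real.log_le_log hl h₁
    have e3 := Real.log_le_log (by positivity) h₂
    have e4 : -1 / 2 ≤ Real.log q.scale := (Real.le_log_iff_exp_le hq).2 ha₀
    have e5 : Real.log q.scale ≤ 1 / 2 := (Real.log_le_iff_le_exp hq).2 ha₁.le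
    rw [abs_le]
    constructor
    · linarith [neg_abs_le (Real.log l), abs_nonneg (Real.log u)]
    · linarith [le_abs_self (Real.log u), abs_nonneg (Real.log l)]
  · have e1 : |Real.exp (-1 / 4) * k * √q.scale| ≤ R + 1 / 2 := by
      rw [abs_le] at h₃ ⊢
      constructor <;> linarith [h₃.1, h₃.2]
    have e2 : |Real.exp (-1 / 4) * k * √q.scale| = Real.exp (-1 / 4) * √q.scale * |(k : ℝ)| := by
      rw [abs_mul, abs_mul, abs_of_pos hp4, abs_of_nonneg (Real.sqrt_nonneg _)]
      ring
    have := mul_le_mul_of_nonneg_right hr₃ (abs_nonneg (k : ℝ))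
    linarith
  · set g := latticePoint j k m * q
    have t0 : g.trans 0 = q.trans 0 + (q.scale * Real.exp (-1 / 2) * m 0 +
        q.shear * (√q.scale * Real.exp (-1 / 2) * m 1)) := by
      simp [g, latticePoint, shearScale_apply_zero]
      ring
    have t1 : g.trans 1 = q.trans 1 + √q.scale * Real.exp (-1 / 2) * m 1 := by
      simp [g, latticePoint, shearScale_apply_one]
      ring
    have n0 := abs_le.1 (Plane.abs_apply_le_norm g.trans 0)
    have n1 := abs_le.1 (Plane.abs_apply_le_norm g.trans 1)
    have b0 := ht 0
    have b1 := ht 1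
    have f1 : |√q.scale * Real.exp (-1 / 2) * m 1| ≤ ‖g.trans‖ + 1 / 2 :=
      abs_le.2 ⟨by linarith [b1.1, b1.2], by linarith [b1.1, b1.2]⟩
    -- The shear mixes m₁ into the first coordinate, so m₁ is bounded first and its contribution
    -- then subtracted.
    have f2 : |q.shear * (√q.scale * Real.exp (-1 / 2) * m 1)| ≤ 1 / 2 * (‖g.trans‖ + 1 / 2) := by
      rw [abs_mul]
      exact mul_le_mul (abs_le.2 ⟨by linarith, hs₁.le⟩) f1 (abs_nonneg _) (by norm_num)
    have f0 : |q.scale * Real.exp (-1 / 2) * m 0| ≤ 3 / 2 * ‖g.trans‖ + 3 / 4 := by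
      have := abs_le.1 f2
      exact abs_le.2 ⟨by linarith [b0.1, b0.2], by linarith [b0.1, b0.2]⟩
    rw [abs_mul, abs_of_pos (by linarith)] at f0 f1
    have hm : ‖m‖ ≤ 5 * ‖g.trans‖ + 5 := by
      refine (pi_norm_le_iff_of_nonneg (by positivity)).2 fun i => ?_
      rw [Int.norm_eq_abs]
      fin_cases i
      · change |((m 0 : ℤ) : ℝ)| ≤ _
        have := mul_le_mul_of_nonneg_right hq₂ (abs_nonneg (m 0 : ℝ))
        linarith [norm_nonneg g.trans]
      · change |((m 1 : ℤ) : ℝ)| ≤ _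
        have := mul_le_mul_of_nonneg_right hr₂ (abs_nonneg (m 1 : ℝ))
        linarith [norm_nonneg g.trans]
    linarith [norm_nonneg g.trans]

/-- Each box supremum is at most a product U(j) V(k) W(m) of summable factors, so the triple sum
splits. -/
theorem amalgamNorm_one_lt_top_of_bound {F : ShearletGroup → ℂ} {l u R C : ℝ}
    (hl : 0 < l) (hC : 0 ≤ C)
    (hsupp : ∀ g, F g ≠ 0 → l ≤ g.scale ∧ g.scale ≤ u ∧ |g.shear| ≤ R)
    (hbound : ∀ g, ‖F g‖ ≤ C / (1 + ‖g.trans‖) ^ 3) : amalgamNorm 1 F < ∞ := by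
  set U : ℤ → ℝ := {n : ℤ | |(n : ℝ)| ≤ |Real.log l| + |Real.log u| + 1}.indicator 1
  set V : ℤ → ℝ := {n : ℤ | |(n : ℝ)| ≤ 3 * (R + 1)}.indicator 1
  set W : (Fin 2 → ℤ) → ℝ := fun m => C * 18 ^ 3 * (1 / (1 + ‖m‖) ^ 3)
  have hU0 : ∀ j, 0 ≤ U j := fun j => Set.indicator_nonneg (fun _ _ => zero_le_one) _
  have hV0 : ∀ j, 0 ≤ V j := fun j => Set.indicator_nonneg (fun _ _ => zero_le_one) _
  have hW0 : ∀ m, 0 ≤ W m := fun m => by positivity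
  have hU : Summable U := Int.summable_indicator_abs_cast_le _
  have hV : Summable V := Int.summable_indicator_abs_cast_le _
  have hW : Summable W := summable_one_div_one_add_norm_cube.mul_left _
  have key : ∀ j k m, eLpNorm ((box 1 (latticePoint j k m)).indicator F) ∞ haar ≤
      ENNReal.ofReal (U j) * (ENNReal.ofReal (V k) * ENNReal.ofReal (W m)) := fun j k m => by
    rw [← ENNReal.ofReal_mul (hV0 k), ← ENNReal.ofReal_mul (hU0 j), eLpNorm_exponent_top]
    refine eLpNormEssSup_le_of_ae_bound (Filter.Eventually.of_forall fun g => ?_)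
    have hnn : 0 ≤ U j * (V k * W m) := mul_nonneg (hU0 j) (mul_nonneg (hV0 k) (hW0 m))
    by_cases hg : g ∈ box 1 (latticePoint j k m)
    · rw [Set.indicator_of_mem hg]
      by_cases h0 : F g = 0
      · simpa [h0] using hnn
      obtain ⟨h1, h2, h3⟩ := hsupp g h0
      obtain ⟨p1, p2, p3⟩ := abs_le_of_mem_box hg hl h1 h2 h3
      have e1 : U j = 1 := Set.indicator_of_mem (by exact p1) _
      have e2 : V k = 1 := Set.indicator_of_mem (by exact p2) _
      rw [e1, e2, one_mul, one_mul]
      refine (hbound g).trans ?_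
      simp only [W]
      rw [mul_one_div, div_le_div_iff₀ (by positivity) (by positivity), mul_assoc, ← mul_pow]
      gcongr
    · simpa [Set.indicator_of_notMem hg] using hnn
  simp only [amalgamNorm, ENNReal.rpow_one, div_one]
  refine (ENNReal.tsum_le_tsum fun j => ENNReal.tsum_le_tsum fun k =>
    ENNReal.tsum_le_tsum fun m => key j k m).trans_lt ?_
  simp_rw [ENNReal.tsum_mul_left, ENNReal.tsum_mul_right]
  exact ENNReal.mul_lt_top hU.tsum_ofReal_lt_top
    (ENNReal.mul_lt_top hV.tsum_ofReal_lt_top hW.tsum_ofReal_lt_top)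

end ShearletGroup

theorem mainTheorem4 (f ψ : SchwartzMap Plane ℂ)
    (hf : f ∈ generatorClass) (hψ : ψ ∈ generatorClass) :
    shearletTransform ψ f ∈ continuousAmalgamSpace 1 := by
  obtain ⟨l, u, R, hl, hsupp⟩ := exists_scale_shear_support hf hψ
  obtain ⟨C, hC, hdecay⟩ := exists_norm_shearletTransform_le ψ f u R
  have hcont := continuous_shearletTransform ψ f
  have hbound : ∀ g, ‖shearletTransform ψ f g‖ ≤ C / (1 + ‖g.trans‖) ^ 3 := fun g => by
    by_cases hg : shearletTransform ψ f g = 0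
    · rw [hg, norm_zero]
      positivity
    · exact hdecay g (hsupp g hg).2.1 (hsupp g hg).2.2
  refine ⟨⟨?_, amalgamNorm_one_lt_top_of_bound hl hC hsupp hbound⟩, hcont⟩
  rw [ENNReal.ofReal_one, memLp_one_iff_integrable]
  exact integrable_haar_of_bound hcont hl hsupp hbound
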